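/- Let $M$ be an $n$-dimensional $C^\infty$ manifold. A Finsler space $F^n=(M,L)$ consists of a $C^\infty$ function $L>0$ on an open conic set $\mathcal A\subseteq TM\setminus 0$ meeting every tangent space (classically $\mathcal A=TM\setminus 0$) that is positively homogeneous of degree one in $y$ and whose metric tensor $g_{ij}=\tfrac12\dot\partial_i\dot\partial_jL^2$ is nondegenerate on $\mathcal A$ (in particular, it may be positive definite); here $\partial_i=\partial/\partial x^i$ and $\dot\partial_i=\partial/\partial y^i$ in the coordinates $(x^i,y^i)$ of $TM$ induced by a chart of $M$, and repeated indices are summed. Put $$\gamma^i_{jk}=\tfrac12 g^{ir}(\partial_jg_{kr}+\partial_kg_{jr}-\partial_rg_{jk}),\quad G^i=\tfrac12\gamma^i_{jk}y^jy^k,\quad N^i_j=\dot\partial_jG^i,\quad G^i_{jk}=\dot\partial_kN^i_j,$$ $$\delta_i=\partial_i-N^r_i\dot\partial_r,\qquad \Gamma^i_{jk}=\tfrac12 g^{ir}(\delta_jg_{kr}+\delta_kg_{jr}-\delta_rg_{jk}).$$ $F^n$ is a Berwald space if in every chart the coefficients $G^i_{jk}$ are functions of $x$ only. A covector field $b_i(x)$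 is Cartan-parallel in $F^n$ if $b_{i|j}:=\delta_jb_i-b_r\Gamma^r_{ij}=0$ on $\mathcal A$. A smooth function $\sigma$ on $M$ is homothetic if $\sigma_i:=\partial_i\sigma=0$, i.e. $\sigma$ is locally constant. Let $F^n=(M,L)$ and $\overline F^n=(M,\overline L)$ be Finsler spaces, the latter given on an open conic set $\overline{\mathcal A}\subseteq\mathcal A$, that are related by a generalized $\beta$-conformal change $$\overline L(x,y)=f\bigl(e^{\sigma(x)}L(x,y),\beta(x,y)\bigr),\qquad (x,y)\in\overline{\mathcal A},$$ where $\sigma$ is a smooth function on $M$, $\beta=b_i(x)\,y^i$ for a smooth covector field $b_i(x)$ on $M$, and $f$ is a smooth positively homogeneous function of degree one on an open conic subset of $\mathbb R^2$ containing all the pairs $(e^{\sigma}L,\beta)$ that occur. Theorem. Suppose that $b_i(x)$ is Cartan-parallel in $F^n$ and that $\sigma$ is homothetic. If $F^n$ is a Berwald space, then so is the transformed space $\overline F^n$. -/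

import Mathlib

open scoped Manifold ContDiff

noncomputable section

namespace FinslerGeometry

/-! ### Local formulas

Functions of the `2n` local coordinates `(x, y)` of the tangent bundle; a point of the coordinate
space is a pair `z = (x, y)`. -/

/-- The coordinate space `ℝⁿ`. -/
abbrev E (n : ℕ) : Type := EuclideanSpace ℝ (Fin n)

/-- The operator `∂ᵢ = ∂/∂xⁱ`. -/
def dX {n : ℕ} (i : Fin n) (u : E n × E n → ℝ) (z : E n × E n) : ℝ :=
  fderiv ℝ u z (EuclideanSpace.single i 1, 0)

/-- The operator `∂̇ᵢ = ∂/∂yⁱ`. -/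
def dY {n : ℕ} (i : Fin n) (u : E n × E n → ℝ) (z : E n × E n) : ℝ :=
  fderiv ℝ u z (0, EuclideanSpace.single i 1)

/-- The Finsler metric tensor `g_{ij} = ½ ∂̇ᵢ ∂̇ⱼ L²`. -/
def metric {n : ℕ} (L : E n × E n → ℝ) (i j : Fin n) (z : E n × E n) : ℝ :=
  (1 / 2) * dY i (dY j (fun w => L w ^ 2)) z

/-- The matrix `(g_{ij})` at a point. -/
def metricMatrix {n : ℕ} (L : E n × E n → ℝ) (z : E n × E n) : Matrix (Fin n) (Fin n) ℝ :=
  Matrix.of fun i j => metric L i j z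

/-- The inverse metric `g^{ij}`. -/
def invMetric {n : ℕ} (L : E n × E n → ℝ) (i j : Fin n) (z : E n × E n) : ℝ :=
  (metricMatrix L z)⁻¹ i j

/-- The Christoffel symbols with respect to `∂ᵢ`:
`γ^i_{jk} = ½ g^{ir} (∂ⱼ g_{kr} + ∂ₖ g_{jr} - ∂ᵣ g_{jk})`. -/
def christoffel {n : ℕ} (L : E n × E n → ℝ) (i j k : Fin n) (z : E n × E n) : ℝ :=
  (1 / 2) * ∑ r, invMetric L i r z *
    (dX j (metric L k r) z + dX k (metric L j r) z - dX r (metric L j k) z)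

/-- The components `G^i = ½ γ^i_{jk} y^j y^k` of the canonical spray. -/
def spray {n : ℕ} (L : E n × E n → ℝ) (i : Fin n) (z : E n × E n) : ℝ :=
  (1 / 2) * ∑ j, ∑ k, christoffel L i j k z * z.2 j * z.2 k

/-- The Barthel (Cartan) nonlinear connection `N^i_j = ∂̇ⱼ G^i`. -/
def barthel {n : ℕ} (L : E n × E n → ℝ) (i j : Fin n) (z : E n × E n) : ℝ :=
  dY j (spray L i) z

/-- The Berwald connection coefficients `G^i_{jk} = ∂̇ₖ N^i_j`. -/
def berwaldCoeff {n : ℕ} (L : E n × E n → ℝ) (i j k : Fin n) (z : E n × E n) : ℝ :=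
  dY k (barthel L i j) z

/-- The horizontal operator `δᵢ = ∂ᵢ - N^r_i ∂̇ᵣ`. -/
def delta {n : ℕ} (L : E n × E n → ℝ) (i : Fin n) (u : E n × E n → ℝ) (z : E n × E n) : ℝ :=
  dX i u z - ∑ r, barthel L r i z * dY r u z

/-- The horizontal coefficients of the Cartan connection:
`Γ^i_{jk} = ½ g^{ir} (δⱼ g_{kr} + δₖ g_{jr} - δᵣ g_{jk})`. -/
def cartanCoeff {n : ℕ} (L : E n × E n → ℝ) (i j k : Fin n) (z : E n × E n) : ℝ :=
  (1 / 2) * ∑ r, invMetric L i r z *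
    (delta L j (metric L k r) z + delta L k (metric L j r) z - delta L r (metric L j k) z)

/-- The horizontal Cartan covariant derivative of a covector field:
`A_{j|k} = δₖ Aⱼ - Aᵣ Γ^r_{jk}`. -/
def cartanHCov {n : ℕ} (L : E n × E n → ℝ) (A : Fin n → E n × E n → ℝ) (j k : Fin n)
    (z : E n × E n) : ℝ :=
  delta L k (A j) z - ∑ r, A r z * cartanCoeff L r j k z

/-! ### Global notions -/

section Manifold

variable {n : ℕ} {M : Type*} [TopologicalSpace M] [ChartedSpace (E n) M]
  [IsManifold (𝓡 n) ∞ M]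

/-- The parametrization of the tangent bundle induced by a chart `φ` of `M`: the pair `(x, y)`
stands for the tangent vector `yⁱ ∂/∂xⁱ` at the point with coordinates `x`. -/
def param (φ : OpenPartialHomeomorph M (E n)) (z : E n × E n) : TangentBundle (𝓡 n) M :=
  tangentMap (𝓡 n) (𝓡 n) φ.symm ⟨z.1, z.2⟩

/-- The part of the coordinate space that corresponds to a set `A` of tangent vectors. -/
def coordDom (φ : OpenPartialHomeomorph M (E n)) (A : Set (TangentBundle (𝓡 n) M)) :
    Set (E n × E n) :=
  {z | z.1 ∈ φ.target ∧ param φ z ∈ A}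

/-- The expression in coordinates of a function on the tangent bundle. -/
def coordFun (φ : OpenPartialHomeomorph M (E n)) (L : TangentBundle (𝓡 n) M → ℝ) :
    E n × E n → ℝ :=
  fun z => L (param φ z)

/-- The components `b_i(x)` of a covector field in a chart. -/
def coordForm (φ : OpenPartialHomeomorph M (E n))
    (b : (p : M) → TangentSpace (𝓡 n) p →L[ℝ] ℝ) (i : Fin n) : E n × E n → ℝ :=
  fun z => b _ (param φ (z.1, EuclideanSpace.single i 1)).2

/-- The function `β(x, y) = b_i(x) y^i` on the tangent bundle. -/
def formFun (b : (p : M) → TangentSpace (𝓡 n) p →L[ℝ] ℝ) : TangentBundle (𝓡 n) M → ℝ :=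
  fun v => b v.1 v.2

variable (n M) in
/-- An `n`-dimensional `C^∞` Finsler space `(M, L)`. The fundamental function is given on an open
conic set `dom` of nonzero tangent vectors that meets every tangent space (the classical case is
the set of all nonzero vectors; metrics such as `L² / β` are only given on a smaller set), and
the metric tensor is nondegenerate there (in particular it may be positive definite). The values
of `L` outside `dom` are irrelevant. -/
structure FinslerSpace where
  /-- the set of tangent vectors on which the fundamental function is given -/
  dom : Set (TangentBundle (𝓡 n) M)
  /-- the fundamental function -/
  L : TangentBundle (𝓡 n) M → ℝ
  isOpen_dom : IsOpen dom
  ne_zero : ∀ v ∈ dom, v.2 ≠ 0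
  smul_mem : ∀ (p : M) (y : TangentSpace (𝓡 n) p) (t : ℝ), 0 < t →
    (⟨p, y⟩ : TangentBundle (𝓡 n) M) ∈ dom → (⟨p, t • y⟩ : TangentBundle (𝓡 n) M) ∈ dom
  fiber_nonempty : ∀ p : M, ∃ y : TangentSpace (𝓡 n) p, (⟨p, y⟩ : TangentBundle (𝓡 n) M) ∈ dom
  smooth : ContMDiffOn (𝓡 n).tangent 𝓘(ℝ, ℝ) ∞ L dom
  pos : ∀ v ∈ dom, 0 < L v
  homogeneous : ∀ (p : M) (y : TangentSpace (𝓡 n) p) (t : ℝ), 0 < t →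
    (⟨p, y⟩ : TangentBundle (𝓡 n) M) ∈ dom → L ⟨p, t • y⟩ = t * L ⟨p, y⟩
  nondegenerate : ∀ φ ∈ IsManifold.maximalAtlas (𝓡 n) ∞ M, ∀ z ∈ coordDom φ dom,
    (metricMatrix (coordFun φ L) z).det ≠ 0

/-- `F` is a Berwald space: in every chart, the coefficients `G^i_{jk}` are functions of the
position `x` only. -/
def FinslerSpace.IsBerwald (F : FinslerSpace n M) : Prop :=
  ∀ φ ∈ IsManifold.maximalAtlas (𝓡 n) ∞ M, ∀ i j k : Fin n, ∀ x y y' : E n,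
    (x, y) ∈ coordDom φ F.dom → (x, y') ∈ coordDom φ F.dom →
      berwaldCoeff (coordFun φ F.L) i j k (x, y) = berwaldCoeff (coordFun φ F.L) i j k (x, y')

/-- The covector field `b` is Cartan-parallel in `F`: `b_{i|j} = 0` in every chart. -/
def FinslerSpace.IsCartanParallel (F : FinslerSpace n M)
    (b : (p : M) → TangentSpace (𝓡 n) p →L[ℝ] ℝ) : Prop :=
  ∀ φ ∈ IsManifold.maximalAtlas (𝓡 n) ∞ M, ∀ i j : Fin n, ∀ z ∈ coordDom φ F.dom,
    cartanHCov (coordFun φ F.L) (coordForm φ b) i j z = 0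

/-- `σ` is homothetic: `σ_i = ∂ᵢ σ = 0`, that is, `σ` is locally constant. -/
def IsHomothetic (σ : M → ℝ) : Prop :=
  ∀ p : M, mfderiv (𝓡 n) 𝓘(ℝ, ℝ) σ p = 0

/-- `Fbar` arises from `F` by the generalized `β`-conformal change
`L(x, y) ↦ L̄(x, y) = f (e^{σ(x)} L(x, y), β(x, y))`, where `β = b_i(x) dx^i`, and `f` is a smooth
positively homogeneous function of degree one on an open conic set `D` of pairs `(L̃, β)`. -/
structure IsGenBetaConformalChange (F Fbar : FinslerSpace n M) (σ : M → ℝ)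
    (b : (p : M) → TangentSpace (𝓡 n) p →L[ℝ] ℝ) (D : Set (ℝ × ℝ)) (f : ℝ × ℝ → ℝ) : Prop where
  smooth_σ : ContMDiff (𝓡 n) 𝓘(ℝ, ℝ) ∞ σ
  smooth_β : ContMDiff (𝓡 n).tangent 𝓘(ℝ, ℝ) ∞ (formFun b)
  isOpen_D : IsOpen D
  smul_mem_D : ∀ w ∈ D, ∀ t : ℝ, 0 < t → t • w ∈ D
  smooth_f : ContDiffOn ℝ ∞ f D
  homogeneous_f : ∀ w ∈ D, ∀ t : ℝ, 0 < t → f (t • w) = t * f w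
  dom_subset : Fbar.dom ⊆ F.dom
  mem_D : ∀ v ∈ Fbar.dom, (Real.exp (σ v.1) * F.L v, formFun b v) ∈ D
  L_eq : ∀ v ∈ Fbar.dom, Fbar.L v = f (Real.exp (σ v.1) * F.L v, formFun b v)

end Manifold

end FinslerGeometry

end

/-! The change does not alter the spray. Let `N` be the Barthel connection of `F` and call a
function horizontally constant if `δ_j u = ∂_j u - N^r_j ∂̇_r u` vanishes. `L` always has this
property (`sum_barthel_mul_dY_sq`); `β` has it because `b` is Cartan-parallel and `y^k Γ^r_{kj} =
N^r_j` (`sum_mul_cartanCoeff`, `dX_coordFun_formFun`); `e^σ` has it because `dσ = 0`. By the chain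
rule so has `L̄ = f(e^σ L, β)`.

Horizontal constancy of `L̄²` determines its spray (`spray_eq_of_horizontal`). Differentiate `∂_k
L̄² = N^r_k ∂̇_r L̄²` in `y^i` and contract with `y^k`, using `y^k N^r_k = 2G^r` and `y^k ∂̇_i N^r_k
= N^r_i`. The Euler-Lagrange equations of `L̄²` then read `ḡ_{ir} Ḡ^r = ḡ_{ir} G^r`, and `ḡ` is
nondegenerate. So `Ḡ^i = G^i` on an open set, and the Berwald coefficients agree there. -/

namespace FinslerGeometry

/-! ### Directional derivatives and smoothness on open sets -/

section Calculus

variable {V : Type*} [NormedAddCommGroup V] [NormedSpace ℝ V] {U : Set V} {u w : V → ℝ} {z : V}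

theorem differentiableAt_of_smoothOn (hU : IsOpen U) (hu : ContDiffOn ℝ ∞ u U) (hz : z ∈ U) :
    DifferentiableAt ℝ u z :=
  (hu.contDiffAt (hU.mem_nhds hz)).differentiableAt (by simp)

theorem smoothOn_fderiv_apply (hU : IsOpen U) (hu : ContDiffOn ℝ ∞ u U) (v : V) :
    ContDiffOn ℝ ∞ (fun z => fderiv ℝ u z v) U :=
  (hu.fderiv_of_isOpen hU (m := ∞) (by simp)).clm_apply contDiffOn_const

theorem fderiv_apply_comm (hU : IsOpen U) (hu : ContDiffOn ℝ ∞ u U) (hz : z ∈ U) (v v' : V) :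
    fderiv ℝ (fun z => fderiv ℝ u z v) z v' = fderiv ℝ (fun z => fderiv ℝ u z v') z v := by
  have hd : DifferentiableAt ℝ (fderiv ℝ u) z :=
    ((hu.fderiv_of_isOpen hU (m := ∞) (by simp)).contDiffAt
      (hU.mem_nhds hz)).differentiableAt (by simp)
  have hs : IsSymmSndFDerivAt ℝ u z :=
    (hu.contDiffAt (hU.mem_nhds hz)).isSymmSndFDerivAt (by
      rw [minSmoothness_of_isRCLikeNormedField]; exact WithTop.coe_le_coe.2 le_top)
  rw [fderiv_clm_apply hd (differentiableAt_const _), fderiv_clm_apply hd (differentiableAt_const _)]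
  simpa using hs v' v

/-- Identities are stated on all of an open set so that this lemma can differentiate them. -/
theorem fderiv_apply_congr (hU : IsOpen U) (h : ∀ z ∈ U, u z = w z) (hz : z ∈ U) (v : V) :
    fderiv ℝ u z v = fderiv ℝ w z v := by
  rw [Filter.EventuallyEq.fderiv_eq (f := w)]
  filter_upwards [hU.mem_nhds hz] with a ha using h a ha

theorem fderiv_mul_apply (hu : DifferentiableAt ℝ u z) (hw : DifferentiableAt ℝ w z) (v : V) :
    fderiv ℝ (fun z => u z * w z) z v = u z * fderiv ℝ w z v + w z * fderiv ℝ u z v := by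
  rw [fderiv_fun_mul hu hw]; simp

theorem fderiv_const_mul_apply (hu : DifferentiableAt ℝ u z) (c : ℝ) (v : V) :
    fderiv ℝ (fun z => c * u z) z v = c * fderiv ℝ u z v := by
  rw [fderiv_const_mul hu]; simp

theorem fderiv_sum_mul_apply {ι : Type*} [Fintype ι] {a c : ι → V → ℝ}
    (ha : ∀ i, DifferentiableAt ℝ (a i) z) (hc : ∀ i, DifferentiableAt ℝ (c i) z) (v : V) :
    fderiv ℝ (fun z => ∑ i, a i z * c i z) z v =
      ∑ i, (a i z * fderiv ℝ (c i) z v + c i z * fderiv ℝ (a i) z v) := by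
  rw [fderiv_fun_sum (fun i _ => (ha i).fun_mul (hc i)), sum_apply]
  exact Finset.sum_congr rfl fun i _ => fderiv_mul_apply (ha i) (hc i) v

theorem contDiffOn_det {m : ℕ} {A : V → Matrix (Fin m) (Fin m) ℝ}
    (hA : ∀ i j, ContDiffOn ℝ ∞ (fun z => A z i j) U) : ContDiffOn ℝ ∞ (fun z => (A z).det) U := by
  simp only [Matrix.det_apply']
  exact ContDiffOn.sum fun s _ => contDiffOn_const.mul (contDiffOn_prod fun i _ => hA _ _)

theorem contDiffOn_matrix_inv {m : ℕ} {A : V → Matrix (Fin m) (Fin m) ℝ}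
    (hA : ∀ i j, ContDiffOn ℝ ∞ (fun z => A z i j) U) (hdet : ∀ z ∈ U, (A z).det ≠ 0)
    (i j : Fin m) : ContDiffOn ℝ ∞ (fun z => (A z)⁻¹ i j) U := by
  simp only [Matrix.inv_def, Matrix.smul_apply, smul_eq_mul, Ring.inverse_eq_inv',
    Matrix.adjugate_apply]
  refine ((contDiffOn_det hA).inv hdet).mul (contDiffOn_det fun k l => ?_)
  -- The adjugate entry is the determinant of `A` with row `j` replaced by a constant basis vector.
  by_cases h : k = j
  · subst h; simpa using contDiffOn_const
  · simpa [Matrix.updateRow_ne h] using hA k l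

end Calculus

/-! ### Calculus in the coordinates `(x, y)` and Euler's theorem -/

section Local

variable {n : ℕ} {U : Set (E n × E n)} {L : E n × E n → ℝ} {u w : E n × E n → ℝ} {z : E n × E n}

theorem smooth_coord (i : Fin n) : ContDiff ℝ ∞ (fun z : E n × E n => z.2 i) := by
  fun_prop

theorem fderiv_coord (i : Fin n) (v : E n × E n) :
    fderiv ℝ (fun z : E n × E n => z.2 i) z v = v.2 i := by
  have h : HasFDerivAt (fun z : E n × E n => z.2 i)
      ((EuclideanSpace.proj i : E n →L[ℝ] ℝ).comp (ContinuousLinearMap.snd ℝ (E n) (E n))) z :=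
    ((EuclideanSpace.proj i : E n →L[ℝ] ℝ).comp
      (ContinuousLinearMap.snd ℝ (E n) (E n))).hasFDerivAt
  rw [h.fderiv]; simp

/-- The product rule for a contraction `y^i c_i`. -/
theorem dY_sum_coord_mul {c : Fin n → E n × E n → ℝ} (hc : ∀ i, DifferentiableAt ℝ (c i) z)
    (j : Fin n) :
    dY j (fun z => ∑ i, z.2 i * c i z) z = c j z + ∑ i, z.2 i * dY j (c i) z := by
  unfold dY
  rw [fderiv_sum_mul_apply (fun i => ((smooth_coord i).differentiable (by simp)) z) hc]
  simp [fderiv_coord, Finset.sum_add_distrib, add_comm]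

theorem smooth_dX (hU : IsOpen U) (hu : ContDiffOn ℝ ∞ u U) (i : Fin n) :
    ContDiffOn ℝ ∞ (dX i u) U := smoothOn_fderiv_apply hU hu _

theorem smooth_dY (hU : IsOpen U) (hu : ContDiffOn ℝ ∞ u U) (i : Fin n) :
    ContDiffOn ℝ ∞ (dY i u) U := smoothOn_fderiv_apply hU hu _

theorem dY_dY_comm (hU : IsOpen U) (hu : ContDiffOn ℝ ∞ u U) (hz : z ∈ U) (i j : Fin n) :
    dY i (dY j u) z = dY j (dY i u) z := fderiv_apply_comm hU hu hz _ _

theorem dY_dX_comm (hU : IsOpen U) (hu : ContDiffOn ℝ ∞ u U) (hz : z ∈ U) (i j : Fin n) :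
    dY i (dX j u) z = dX j (dY i u) z := fderiv_apply_comm hU hu hz _ _

/-- Euler's theorem on homogeneous functions, in the variable `y`. -/
theorem euler_of_homogeneous (hU : IsOpen U) (hu : ContDiffOn ℝ ∞ u U) (k : ℕ)
    (hom : ∀ x y, (x, y) ∈ U → ∀ t : ℝ, 0 < t → u (x, t • y) = t ^ k * u (x, y)) (hz : z ∈ U) :
    ∑ i, z.2 i * dY i u z = k * u z := by
  have hlin : ∑ i, z.2 i * dY i u z = fderiv ℝ u z (0, z.2) := by
    have : ((0, z.2) : E n × E n) = ∑ i, z.2 i • ((0 : E n), EuclideanSpace.single i (1 : ℝ)) := by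
      ext j
      · simp [Prod.fst_sum]
      · simp [Prod.snd_sum, Pi.single_apply]
    rw [this, map_sum]
    simp only [map_smul, smul_eq_mul, dY]
  rw [hlin]
  have hg : HasDerivAt (fun t : ℝ => (z.1, t • z.2)) ((0 : E n), z.2) 1 := by
    have h2 : HasDerivAt (fun t : ℝ => t • z.2) ((1 : ℝ) • z.2) 1 :=
      (hasDerivAt_id (1 : ℝ)).smul_const z.2
    rw [one_smul] at h2
    exact (hasDerivAt_const (1 : ℝ) z.1).prodMk h2
  have hu' : HasFDerivAt u (fderiv ℝ u z) ((fun t : ℝ => (z.1, t • z.2)) 1) := by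
    simpa using (differentiableAt_of_smoothOn hU hu hz).hasFDerivAt
  have h1 := hu'.comp_hasDerivAt 1 hg
  have h2 : HasDerivAt (fun t : ℝ => t ^ k * u z) (k * u z) 1 := by
    simpa using (hasDerivAt_pow k (1 : ℝ)).mul_const (u z)
  refine h1.unique (h2.congr_of_eventuallyEq ?_)
  filter_upwards [lt_mem_nhds (zero_lt_one (α := ℝ))] with t ht using hom z.1 z.2 hz t ht

end Local

end FinslerGeometry

namespace FinslerGeometry

/-! ### The spray, the Barthel connection and horizontal constancy -/

section Spray

variable {n : ℕ} {U : Set (E n × E n)} {L : E n × E n → ℝ} {z : E n × E n}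

/-- A regular Finsler function on an open set of the coordinate space: it is smooth, its square
satisfies Euler's identity in `y`, and its metric tensor is nondegenerate. -/
structure IsLocalFinsler (U : Set (E n × E n)) (L : E n × E n → ℝ) : Prop where
  isOpen : IsOpen U
  smooth : ContDiffOn ℝ ∞ L U
  euler : ∀ z ∈ U, ∑ i, z.2 i * dY i (fun w => L w ^ 2) z = 2 * L z ^ 2
  det_ne_zero : ∀ z ∈ U, (metricMatrix L z).det ≠ 0

theorem sum_metric_mul_sum_invMetric_mul (hdet : (metricMatrix L z).det ≠ 0) (W : Fin n → ℝ)
    (i : Fin n) : ∑ r, metric L i r z * ∑ s, invMetric L r s z * W s = W i := by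
  have h : (metricMatrix L z).mulVec ((metricMatrix L z)⁻¹.mulVec W) = W := by
    rw [Matrix.mulVec_mulVec, Matrix.mul_nonsing_inv _ (isUnit_iff_ne_zero.2 hdet),
      Matrix.one_mulVec]
  exact congrFun h i

/-- Nondegeneracy lets identities with an upper index be checked after lowering it, which keeps
derivatives of the inverse metric out of the computations. -/
theorem eq_of_sum_metric_mul_eq (hdet : (metricMatrix L z).det ≠ 0) {a c : Fin n → ℝ}
    (h : ∀ i, ∑ r, metric L i r z * a r = ∑ r, metric L i r z * c r) (r : Fin n) : a r = c r :=
  congrFun (Matrix.mulVec_injective_of_isUnit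
    ((Matrix.isUnit_iff_isUnit_det _).2 (isUnit_iff_ne_zero.2 hdet)) (funext h)) r

/-- Contraction with `y` of an identity shaped like `sum_metric_mul_barthel`. -/
theorem sum_mul_add_eq {ι : Type*} [Fintype ι] (y : ι → ℝ) {a c d e k : ι → ℝ}
    (h : ∀ i, a i + c i = 1 / 4 * (d i + 2 * e i - k i)) :
    ∑ i, y i * a i + ∑ i, y i * c i =
      1 / 4 * (∑ i, y i * d i + 2 * ∑ i, y i * e i - ∑ i, y i * k i) := by
  simp only [Finset.mul_sum, ← Finset.sum_add_distrib, ← Finset.sum_sub_distrib]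
  exact Finset.sum_congr rfl fun i _ => by linear_combination y i * h i

namespace IsLocalFinsler

variable (hL : IsLocalFinsler U L)
include hL

theorem smooth_sq : ContDiffOn ℝ ∞ (fun w => L w ^ 2) U := hL.smooth.pow 2

theorem smooth_metric (i j : Fin n) : ContDiffOn ℝ ∞ (metric L i j) U :=
  contDiffOn_const.mul (smooth_dY hL.isOpen (smooth_dY hL.isOpen hL.smooth_sq j) i)

theorem smooth_invMetric (i j : Fin n) : ContDiffOn ℝ ∞ (invMetric L i j) U :=
  contDiffOn_matrix_inv (A := metricMatrix L) hL.smooth_metric hL.det_ne_zero i j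

theorem smooth_spray (i : Fin n) : ContDiffOn ℝ ∞ (spray L i) U := by
  have hg := fun i j k => smooth_dX hL.isOpen (hL.smooth_metric i j) k
  refine contDiffOn_const.mul (ContDiffOn.sum fun j _ => ContDiffOn.sum fun k _ =>
    ((contDiffOn_const.mul (ContDiffOn.sum fun r _ => ?_)).mul
      (smooth_coord j).contDiffOn).mul (smooth_coord k).contDiffOn)
  exact (hL.smooth_invMetric i r).mul (((hg k r j).add (hg j r k)).sub (hg j k r))

theorem smooth_barthel (i j : Fin n) : ContDiffOn ℝ ∞ (barthel L i j) U :=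
  smooth_dY hL.isOpen (hL.smooth_spray i) j

theorem metric_comm (hz : z ∈ U) (i j : Fin n) : metric L i j z = metric L j i z := by
  rw [metric, metric, dY_dY_comm hL.isOpen hL.smooth_sq hz]

theorem dX_metric_comm (hz : z ∈ U) (i j k : Fin n) :
    dX k (metric L i j) z = dX k (metric L j i) z :=
  fderiv_apply_congr hL.isOpen (fun _ hz => hL.metric_comm hz i j) hz _

theorem dX_metric (hz : z ∈ U) (i j k : Fin n) :
    dX k (metric L i j) z = 1 / 2 * dX k (dY i (dY j (fun w => L w ^ 2))) z :=
  fderiv_const_mul_apply (differentiableAt_of_smoothOn hL.isOpen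
    (smooth_dY hL.isOpen (smooth_dY hL.isOpen hL.smooth_sq j) i) hz) _ _

theorem dY_metric (hz : z ∈ U) (i j k : Fin n) :
    dY k (metric L i j) z = 1 / 2 * dY k (dY i (dY j (fun w => L w ^ 2))) z :=
  fderiv_const_mul_apply (differentiableAt_of_smoothOn hL.isOpen
    (smooth_dY hL.isOpen (smooth_dY hL.isOpen hL.smooth_sq j) i) hz) _ _

theorem dY_metric_comm (hz : z ∈ U) (i j k : Fin n) :
    dY k (metric L i j) z = dY k (metric L j i) z :=
  fderiv_apply_congr hL.isOpen (fun _ hz => hL.metric_comm hz i j) hz _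

/-- Third `y`-derivatives of `L²` commute; with the symmetry of `g`, this makes `∂̇_k g_{ij}`
totally symmetric. -/
theorem dY_metric_comm' (hz : z ∈ U) (i j k : Fin n) :
    dY k (metric L i j) z = dY i (metric L k j) z := by
  rw [hL.dY_metric hz, hL.dY_metric hz,
    dY_dY_comm hL.isOpen (smooth_dY hL.isOpen hL.smooth_sq j) hz]

/-- The `y^j`-derivative of Euler's identity for `L²`. -/
theorem sum_mul_metric (hz : z ∈ U) (j : Fin n) :
    ∑ i, z.2 i * metric L i j z = 1 / 2 * dY j (fun w => L w ^ 2) z := by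
  have hd := fun i => differentiableAt_of_smoothOn hL.isOpen
    (smooth_dY hL.isOpen hL.smooth_sq i) hz
  have h1 : dY j (fun z => ∑ i, z.2 i * dY i (fun w => L w ^ 2) z) z =
      2 * dY j (fun w => L w ^ 2) z :=
    (fderiv_apply_congr hL.isOpen hL.euler hz _).trans
      (fderiv_const_mul_apply (differentiableAt_of_smoothOn hL.isOpen hL.smooth_sq hz) _ _)
  rw [dY_sum_coord_mul hd] at h1
  have h2 : ∑ i, z.2 i * metric L i j z =
      1 / 2 * ∑ i, z.2 i * dY j (dY i (fun w => L w ^ 2)) z := by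
    rw [Finset.mul_sum]
    refine Finset.sum_congr rfl fun i _ => ?_
    rw [metric, dY_dY_comm hL.isOpen hL.smooth_sq hz]; ring
  linarith

/-- Differentiating `sum_mul_metric` in `y^k` produces `g_{kj}` on both sides; what remains is the
vanishing of the Cartan tensor contracted with `y`. -/
theorem sum_mul_dY_metric (hz : z ∈ U) (j k : Fin n) :
    ∑ i, z.2 i * dY k (metric L i j) z = 0 := by
  have h1 := fderiv_apply_congr hL.isOpen (fun z hz => hL.sum_mul_metric hz j) hz
    (0, EuclideanSpace.single k 1)
  change dY k _ z = _ at h1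
  rw [dY_sum_coord_mul (fun i => differentiableAt_of_smoothOn hL.isOpen (hL.smooth_metric i j) hz),
    fderiv_const_mul_apply (differentiableAt_of_smoothOn hL.isOpen
      (smooth_dY hL.isOpen hL.smooth_sq j) hz)] at h1
  have h2 : metric L k j z = 1 / 2 * dY k (dY j (fun w => L w ^ 2)) z := rfl
  rw [dY] at h2
  linarith

theorem sum_mul_dY_metric' (hz : z ∈ U) (i j : Fin n) :
    ∑ k, z.2 k * dY k (metric L i j) z = 0 := by
  rw [← hL.sum_mul_dY_metric hz j i]
  exact Finset.sum_congr rfl fun k _ => by rw [hL.dY_metric_comm' hz]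

theorem sum_mul_dX_metric (hz : z ∈ U) (j k : Fin n) :
    ∑ i, z.2 i * dX k (metric L i j) z = 1 / 2 * dX k (dY j (fun w => L w ^ 2)) z := by
  have h1 := fderiv_apply_congr hL.isOpen (fun z hz => hL.sum_mul_metric hz j) hz
    (EuclideanSpace.single k 1, 0)
  rw [fderiv_sum_mul_apply (fun i => ((smooth_coord i).differentiable (by simp)) z)
    (fun i => differentiableAt_of_smoothOn hL.isOpen (hL.smooth_metric i j) hz),
    fderiv_const_mul_apply (differentiableAt_of_smoothOn hL.isOpen
      (smooth_dY hL.isOpen hL.smooth_sq j) hz)] at h1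
  simpa [fderiv_coord, dX] using h1

theorem sum_mul_dX_dY (hz : z ∈ U) (k : Fin n) :
    ∑ j, z.2 j * dX k (dY j (fun w => L w ^ 2)) z = 2 * dX k (fun w => L w ^ 2) z := by
  have h1 := fderiv_apply_congr hL.isOpen hL.euler hz (EuclideanSpace.single k 1, 0)
  rw [fderiv_sum_mul_apply (fun i => ((smooth_coord i).differentiable (by simp)) z)
    (fun i => differentiableAt_of_smoothOn hL.isOpen (smooth_dY hL.isOpen hL.smooth_sq i) hz),
    fderiv_const_mul_apply (differentiableAt_of_smoothOn hL.isOpen hL.smooth_sq hz)] at h1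
  simpa [fderiv_coord, dX] using h1

/-- The Euler-Lagrange equations of `L²`, which characterize the canonical spray. -/
theorem sum_metric_mul_spray (hz : z ∈ U) (i : Fin n) :
    ∑ r, metric L i r z * spray L r z =
      1 / 4 * (∑ k, z.2 k * dX k (dY i (fun w => L w ^ 2)) z - dX i (fun w => L w ^ 2) z) := by
  -- `W` is the spray with its index lowered; the `1/4` combines the halves in `spray` and
  -- `christoffel`.
  set W : Fin n → ℝ := fun s => 1 / 4 * ∑ j, ∑ k, (dX j (metric L k s) z + dX k (metric L j s) z
    - dX s (metric L j k) z) * z.2 j * z.2 k with hW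
  have hs : ∀ r, spray L r z = ∑ s, invMetric L r s z * W s := by
    intro r
    simp only [spray, christoffel, hW, Finset.mul_sum, Finset.sum_mul]
    rw [Finset.sum_comm_cycle]
    refine Finset.sum_congr rfl fun s _ => Finset.sum_congr rfl fun j _ =>
      Finset.sum_congr rfl fun k _ => ?_
    ring
  simp only [hs]
  rw [sum_metric_mul_sum_invMetric_mul (hL.det_ne_zero z hz)]
  have h1 : ∑ j, ∑ k, dX j (metric L k i) z * z.2 j * z.2 k =
      1 / 2 * ∑ k, z.2 k * dX k (dY i (fun w => L w ^ 2)) z := by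
    rw [Finset.mul_sum]
    refine Finset.sum_congr rfl fun j _ => ?_
    rw [mul_left_comm, ← hL.sum_mul_dX_metric hz, Finset.mul_sum]
    exact Finset.sum_congr rfl fun k _ => by ring
  have h2 : ∑ j, ∑ k, dX k (metric L j i) z * z.2 j * z.2 k =
      1 / 2 * ∑ k, z.2 k * dX k (dY i (fun w => L w ^ 2)) z := by
    rw [← h1, Finset.sum_comm]
    exact Finset.sum_congr rfl fun j _ => Finset.sum_congr rfl fun k _ => by ring
  have h3 : ∑ j, ∑ k, dX i (metric L j k) z * z.2 j * z.2 k = dX i (fun w => L w ^ 2) z := by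
    have h := hL.sum_mul_dX_dY hz i
    have : ∑ j, ∑ k, dX i (metric L j k) z * z.2 j * z.2 k =
        1 / 2 * ∑ k, z.2 k * dX i (dY k (fun w => L w ^ 2)) z := by
      rw [Finset.sum_comm, Finset.mul_sum]
      refine Finset.sum_congr rfl fun k _ => ?_
      rw [mul_left_comm, ← hL.sum_mul_dX_metric hz, Finset.mul_sum]
      exact Finset.sum_congr rfl fun k _ => by ring
    linarith
  simp only [hW, add_mul, sub_mul, Finset.sum_add_distrib, Finset.sum_sub_distrib, h1, h2, h3]
  ring

/-- The derivative of the Euler-Lagrange equations in the variable `y`. -/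
theorem sum_metric_mul_barthel (hz : z ∈ U) (i j : Fin n) :
    ∑ r, metric L i r z * barthel L r j z + ∑ r, spray L r z * dY j (metric L i r) z =
      1 / 4 * (dX j (dY i (fun w => L w ^ 2)) z + 2 * ∑ k, z.2 k * dX k (metric L i j) z
        - dX i (dY j (fun w => L w ^ 2)) z) := by
  have hP := hL.smooth_sq
  have hPi := smooth_dY hL.isOpen hP i
  have h1 := fderiv_apply_congr hL.isOpen (fun z hz => hL.sum_metric_mul_spray hz i) hz
    (0, EuclideanSpace.single j 1)
  have hd := fun k => differentiableAt_of_smoothOn hL.isOpen (smooth_dX hL.isOpen hPi k) hz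
  have hsum : ContDiffOn ℝ ∞ (fun z => ∑ k, z.2 k * dX k (dY i (fun w => L w ^ 2)) z) U :=
    ContDiffOn.sum fun k _ => (smooth_coord k).contDiffOn.mul (smooth_dX hL.isOpen hPi k)
  have hds := differentiableAt_of_smoothOn hL.isOpen hsum hz
  have hdi := differentiableAt_of_smoothOn hL.isOpen (smooth_dX hL.isOpen hP i) hz
  rw [fderiv_sum_mul_apply
    (fun r => differentiableAt_of_smoothOn hL.isOpen (hL.smooth_metric i r) hz)
    (fun r => differentiableAt_of_smoothOn hL.isOpen (hL.smooth_spray r) hz),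
    fderiv_const_mul_apply (hds.fun_sub hdi), fderiv_fun_sub hds hdi, Finset.sum_add_distrib,
    sub_apply] at h1
  have h2 := dY_sum_coord_mul hd j
  have h3 : ∑ k, z.2 k * dY j (dX k (dY i (fun w => L w ^ 2))) z =
      2 * ∑ k, z.2 k * dX k (metric L i j) z := by
    rw [Finset.mul_sum]
    refine Finset.sum_congr rfl fun k _ => ?_
    rw [dY_dX_comm hL.isOpen hPi hz, hL.dX_metric_comm hz, hL.dX_metric hz]
    ring
  have h4 := dY_dX_comm hL.isOpen hP hz j i
  rw [h3] at h2
  refine h1.trans ?_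
  rw [← h4, ← h2]
  rfl

/-- The horizontal derivatives of `L²` vanish. -/
theorem sum_barthel_mul_dY_sq (hz : z ∈ U) (j : Fin n) :
    ∑ r, barthel L r j z * dY r (fun w => L w ^ 2) z = dX j (fun w => L w ^ 2) z := by
  have h := fun i => hL.sum_metric_mul_barthel hz i j
  have h1 : ∑ i, z.2 i * (∑ r, metric L i r z * barthel L r j z) =
      1 / 2 * ∑ r, barthel L r j z * dY r (fun w => L w ^ 2) z := by
    simp only [Finset.mul_sum]
    rw [Finset.sum_comm]
    refine Finset.sum_congr rfl fun r _ => ?_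
    rw [mul_left_comm, ← hL.sum_mul_metric hz, Finset.mul_sum]
    exact Finset.sum_congr rfl fun k _ => by ring
  have h2 : ∑ i, z.2 i * (∑ r, spray L r z * dY j (metric L i r) z) = 0 := by
    -- The spray term drops out because the Cartan tensor is annihilated by `y`.
    simp only [Finset.mul_sum]
    rw [Finset.sum_comm]
    refine Finset.sum_eq_zero fun r _ => ?_
    simp only [mul_left_comm _ (spray L r z), ← Finset.mul_sum, hL.sum_mul_dY_metric hz, mul_zero]
  have h3 := hL.sum_mul_dX_dY hz j
  have h4 : ∑ i, z.2 i * (∑ k, z.2 k * dX k (metric L i j) z) =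
      1 / 2 * ∑ k, z.2 k * dX k (dY j (fun w => L w ^ 2)) z := by
    simp only [Finset.mul_sum]
    rw [Finset.sum_comm]
    refine Finset.sum_congr rfl fun k _ => ?_
    rw [mul_left_comm, ← hL.sum_mul_dX_metric hz, Finset.mul_sum]
    exact Finset.sum_congr rfl fun k _ => by ring
  -- By `h4` the last two terms on the right cancel, leaving `1/4 * 2 ∂_j L²`.
  have h5 := sum_mul_add_eq z.2 h
  linarith

/-- The components of the spray are homogeneous of degree two in `y`. -/
theorem sum_mul_barthel (hz : z ∈ U) (i : Fin n) :
    ∑ j, z.2 j * barthel L i j z = 2 * spray L i z := by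
  revert i
  refine eq_of_sum_metric_mul_eq (hL.det_ne_zero z hz) fun i => ?_
  -- Contracting with `y^j` instead of `y^i` turns the right side into twice that of
  -- `sum_metric_mul_spray`.
  have h := fun j => hL.sum_metric_mul_barthel hz i j
  have h1 : ∑ r, metric L i r z * ∑ j, z.2 j * barthel L r j z =
      ∑ j, z.2 j * ∑ r, metric L i r z * barthel L r j z := by
    simp only [Finset.mul_sum]
    rw [Finset.sum_comm]
    exact Finset.sum_congr rfl fun r _ => Finset.sum_congr rfl fun k _ => by ring
  have h2 : ∑ j, z.2 j * (∑ r, spray L r z * dY j (metric L i r) z) = 0 := by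
    simp only [Finset.mul_sum]
    rw [Finset.sum_comm]
    refine Finset.sum_eq_zero fun r _ => ?_
    simp only [mul_left_comm _ (spray L r z), ← Finset.mul_sum, hL.sum_mul_dY_metric' hz, mul_zero]
  have h3 := hL.sum_mul_dX_dY hz i
  have h4 : ∑ j, z.2 j * (∑ k, z.2 k * dX k (metric L i j) z) =
      1 / 2 * ∑ k, z.2 k * dX k (dY i (fun w => L w ^ 2)) z := by
    simp only [Finset.mul_sum]
    rw [Finset.sum_comm]
    refine Finset.sum_congr rfl fun k _ => ?_
    rw [mul_left_comm, ← hL.sum_mul_dX_metric hz, Finset.mul_sum]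
    exact Finset.sum_congr rfl fun j _ => by rw [hL.dX_metric_comm hz]; ring
  have h5 := sum_mul_add_eq z.2 h
  have h6 := hL.sum_metric_mul_spray hz i
  have h7 : ∑ r, metric L i r z * (2 * spray L r z) = 2 * ∑ r, metric L i r z * spray L r z := by
    rw [Finset.mul_sum]; exact Finset.sum_congr rfl fun r _ => by ring
  rw [h1, h7, h6]
  linarith

/-- Differentiate `y^k N^i_k = 2 G^i` in `y^j`: the right side is `2 N^i_j`, and the product rule
already yields one `N^i_j` on the left. -/
theorem sum_mul_dY_barthel (hz : z ∈ U) (i j : Fin n) :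
    ∑ k, z.2 k * dY j (barthel L i k) z = barthel L i j z := by
  have h1 := fderiv_apply_congr hL.isOpen (fun z hz => hL.sum_mul_barthel hz i) hz
    (0, EuclideanSpace.single j 1)
  change dY j _ z = _ at h1
  rw [dY_sum_coord_mul (fun k => differentiableAt_of_smoothOn hL.isOpen
    (hL.smooth_barthel i k) hz), fderiv_const_mul_apply (differentiableAt_of_smoothOn hL.isOpen
      (hL.smooth_spray i) hz)] at h1
  have h2 : barthel L i j z = dY j (spray L i) z := rfl
  rw [dY] at h2
  linarith

/-- The contraction of the Cartan connection with `y` is the Barthel connection. -/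
theorem sum_mul_cartanCoeff (hz : z ∈ U) (r j : Fin n) :
    ∑ k, z.2 k * cartanCoeff L r k j z = barthel L r j z := by
  revert r
  refine eq_of_sum_metric_mul_eq (hL.det_ne_zero z hz) fun i => ?_
  set W : Fin n → ℝ := fun s => 1 / 2 * ∑ k, z.2 k * (delta L k (metric L j s) z +
    delta L j (metric L k s) z - delta L s (metric L k j) z) with hW
  have hs : ∀ r, ∑ k, z.2 k * cartanCoeff L r k j z = ∑ s, invMetric L r s z * W s := by
    intro r
    simp only [cartanCoeff, hW, Finset.mul_sum]
    rw [Finset.sum_comm]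
    exact Finset.sum_congr rfl fun s _ => Finset.sum_congr rfl fun j _ => by ring
  simp only [hs]
  rw [sum_metric_mul_sum_invMetric_mul (hL.det_ne_zero z hz)]
  -- When `y` meets an index of `g`, the vertical part of `δ` vanishes.
  have hδ : ∀ a c, ∑ k, z.2 k * delta L a (metric L k c) z =
      1 / 2 * dX a (dY c (fun w => L w ^ 2)) z := by
    intro a c
    simp only [delta, mul_sub, Finset.sum_sub_distrib, hL.sum_mul_dX_metric hz, Finset.mul_sum]
    rw [Finset.sum_comm, sub_eq_self]
    refine Finset.sum_eq_zero fun r _ => ?_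
    simp only [mul_left_comm _ (barthel L r a z), ← Finset.mul_sum, hL.sum_mul_dY_metric hz,
      mul_zero]
  -- Here `y` meets the direction of `δ`, so the vertical part survives through `y^k N^r_k = 2 G^r`.
  have h2 : ∑ k, z.2 k * delta L k (metric L j i) z =
      ∑ k, z.2 k * dX k (metric L i j) z - 2 * ∑ r, spray L r z * dY j (metric L i r) z := by
    simp only [delta, mul_sub, Finset.sum_sub_distrib]
    congr 1
    · exact Finset.sum_congr rfl fun k _ => by rw [hL.dX_metric_comm hz]
    · simp only [Finset.mul_sum]
      rw [Finset.sum_comm]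
      refine Finset.sum_congr rfl fun r _ => ?_
      rw [← mul_assoc, ← hL.sum_mul_barthel hz, Finset.sum_mul]
      refine Finset.sum_congr rfl fun k _ => ?_
      rw [hL.dY_metric_comm' hz, hL.dY_metric_comm hz r i]; ring
  have h := hL.sum_metric_mul_barthel hz i j
  simp only [hW, mul_add, mul_sub, Finset.sum_add_distrib, Finset.sum_sub_distrib, hδ, h2]
  linarith

end IsLocalFinsler

/-- If the squared Finsler function `K²` is constant along the horizontal distribution of `L`,
then `K` and `L` have the same spray. -/
theorem spray_eq_of_horizontal {U' : Set (E n × E n)} {K : E n × E n → ℝ}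
    (hL : IsLocalFinsler U L) (hK : IsLocalFinsler U' K) (hsub : U' ⊆ U)
    (hor : ∀ z ∈ U', ∀ j, dX j (fun w => K w ^ 2) z =
      ∑ r, barthel L r j z * dY r (fun w => K w ^ 2) z)
    (hz : z ∈ U') (i : Fin n) : spray K i z = spray L i z := by
  revert i
  refine eq_of_sum_metric_mul_eq (hK.det_ne_zero z hz) fun i => ?_
  rw [hK.sum_metric_mul_spray hz]
  have hP := hK.smooth_sq
  -- The horizontality of `K²`, differentiated in `y^i`.
  have h1 : ∀ k, dX k (dY i (fun w => K w ^ 2)) z =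
      ∑ r, (barthel L r k z * dY i (dY r (fun w => K w ^ 2)) z +
        dY r (fun w => K w ^ 2) z * dY i (barthel L r k) z) := by
    intro k
    rw [← dY_dX_comm hK.isOpen hP hz]
    refine (fderiv_apply_congr hK.isOpen (fun z hz => hor z hz k) hz _).trans ?_
    exact fderiv_sum_mul_apply
      (fun r => differentiableAt_of_smoothOn hL.isOpen (hL.smooth_barthel r k) (hsub hz))
      (fun r => differentiableAt_of_smoothOn hK.isOpen (smooth_dY hK.isOpen hP r) hz) _
  have h2 : ∑ k, z.2 k * dX k (dY i (fun w => K w ^ 2)) z =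
      ∑ r, (2 * spray L r z * dY i (dY r (fun w => K w ^ 2)) z +
        dY r (fun w => K w ^ 2) z * barthel L r i z) := by
    simp only [h1, Finset.mul_sum]
    rw [Finset.sum_comm]
    refine Finset.sum_congr rfl fun r _ => ?_
    rw [← hL.sum_mul_barthel (hsub hz), ← hL.sum_mul_dY_barthel (hsub hz), Finset.sum_mul,
      Finset.mul_sum, ← Finset.sum_add_distrib]
    exact Finset.sum_congr rfl fun k _ => by ring
  rw [h2, hor z hz i, Finset.sum_add_distrib]
  have h3 : ∑ r, dY r (fun w => K w ^ 2) z * barthel L r i z =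
    ∑ r, barthel L r i z * dY r (fun w => K w ^ 2) z :=
    Finset.sum_congr rfl fun k _ => mul_comm _ _
  -- The terms with the undifferentiated connection cancel against `∂_i K²`.
  rw [h3, add_sub_cancel_right, Finset.mul_sum]
  refine Finset.sum_congr rfl fun r _ => ?_
  rw [metric]; ring

end Spray

end FinslerGeometry

namespace FinslerGeometry

/-! ### From the manifold to coordinates -/

section Coordinates

variable {n : ℕ} {M : Type*} [TopologicalSpace M]
  {φ : OpenPartialHomeomorph M (E n)}

theorem isOpen_fst_preimage_target : IsOpen {z : E n × E n | z.1 ∈ φ.target} :=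
  φ.open_target.preimage continuous_fst

variable [ChartedSpace (E n) M] {b : (p : M) → TangentSpace (𝓡 n) p →L[ℝ] ℝ}

/-- The tangent vector at `x` with components `y`. -/
theorem param_mk (x y : E n) :
    param φ (x, y) = ⟨φ.symm x, mfderiv (𝓡 n) (𝓡 n) φ.symm x y⟩ := rfl

theorem param_smul (x y : E n) (t : ℝ) :
    param φ (x, t • y) = ⟨φ.symm x, t • mfderiv (𝓡 n) (𝓡 n) φ.symm x y⟩ := by
  rw [param_mk]
  congr 1
  exact map_smul (mfderiv (𝓡 n) (𝓡 n) φ.symm x) t y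

theorem coordFun_formFun (z : E n × E n) :
    coordFun φ (formFun b) z = ∑ i, z.2 i * coordForm φ b i z := by
  have h : z.2 = ∑ i, z.2 i • EuclideanSpace.single i (1 : ℝ) := by
    ext j; simp [Pi.single_apply]
  let ℓ : E n →L[ℝ] ℝ := (b (φ.symm z.1)).comp (mfderiv (𝓡 n) (𝓡 n) φ.symm z.1)
  have h1 : coordFun φ (formFun b) z = ℓ z.2 := rfl
  have h2 : ∀ i, coordForm φ b i z = ℓ (EuclideanSpace.single i 1) := fun i => rfl
  rw [h1]
  conv_lhs => rw [h]
  simp [map_sum, h2]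

/-- Chain rule with `dσ = 0`; it lets `e^σ` be differentiated as a constant. -/
theorem hasFDerivAt_comp_symm_of_isHomothetic (hφ : φ ∈ IsManifold.maximalAtlas (𝓡 n) ∞ M)
    {σ : M → ℝ} (hs : ContMDiff (𝓡 n) 𝓘(ℝ, ℝ) ∞ σ) (hσ : IsHomothetic (n := n) σ)
    {z : E n × E n} (hz : z.1 ∈ φ.target) :
    HasFDerivAt (fun w : E n × E n => σ (φ.symm w.1)) (0 : E n × E n →L[ℝ] ℝ) z := by
  have h1 : MDifferentiableAt (𝓡 n) (𝓡 n) φ.symm z.1 :=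
    ((contMDiffOn_symm_of_mem_maximalAtlas hφ).contMDiffAt
      (φ.open_target.mem_nhds hz)).mdifferentiableAt (by simp)
  have h2 : MDifferentiableAt (𝓡 n) 𝓘(ℝ, ℝ) σ (φ.symm z.1) :=
    hs.contMDiffAt.mdifferentiableAt (by simp)
  have h3 := (h2.hasMFDerivAt.comp z.1 h1.hasMFDerivAt).hasFDerivAt
  rw [hσ] at h3
  have h4 := h3.comp z hasFDerivAt_fst
  convert! h4 using 1

variable [IsManifold (𝓡 n) ∞ M]

theorem contMDiffOn_param (hφ : φ ∈ IsManifold.maximalAtlas (𝓡 n) ∞ M) :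
    ContMDiffOn 𝓘(ℝ, E n × E n) (𝓡 n).tangent ∞ (param φ) {z | z.1 ∈ φ.target} := by
  have h1 := (contMDiffOn_symm_of_mem_maximalAtlas hφ).contMDiffOn_tangentMapWithin
    (m := ∞) (by simp) φ.open_target.uniqueMDiffOn
  have h2 := contMDiff_tangentBundleModelSpaceHomeomorph_symm (I := 𝓡 n) (n := ∞)
  have h3 : ContMDiff 𝓘(ℝ, E n × E n) (𝓡 n).tangent ∞
      (fun z : E n × E n => (⟨z.1, z.2⟩ : TangentBundle (𝓡 n) (E n))) := by
    rw [modelWithCornersSelf_prod]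
    exact h2
  refine (h1.comp h3.contMDiffOn fun z hz => hz).congr fun z hz => ?_
  -- `param` uses the unrestricted tangent map, which agrees with the one within the open chart
  -- target.
  exact (tangentMapWithin_eq_tangentMap (φ.open_target.uniqueMDiffOn _ hz)
    (((contMDiffOn_symm_of_mem_maximalAtlas hφ).contMDiffAt
      (φ.open_target.mem_nhds hz)).mdifferentiableAt (by simp))).symm

theorem isOpen_coordDom (hφ : φ ∈ IsManifold.maximalAtlas (𝓡 n) ∞ M)
    {A : Set (TangentBundle (𝓡 n) M)} (hA : IsOpen A) : IsOpen (coordDom φ A) :=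
  (contMDiffOn_param hφ).continuousOn.isOpen_inter_preimage isOpen_fst_preimage_target hA

theorem contDiffOn_coordFun (hφ : φ ∈ IsManifold.maximalAtlas (𝓡 n) ∞ M)
    {A : Set (TangentBundle (𝓡 n) M)} {u : TangentBundle (𝓡 n) M → ℝ}
    (hu : ContMDiffOn (𝓡 n).tangent 𝓘(ℝ, ℝ) ∞ u A) :
    ContDiffOn ℝ ∞ (coordFun φ u) (coordDom φ A) :=
  contMDiffOn_iff_contDiffOn.1
    (hu.comp ((contMDiffOn_param hφ).mono fun _ hz => hz.1) fun _ hz => hz.2)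

theorem FinslerSpace.isLocalFinsler (F : FinslerSpace n M)
    (hφ : φ ∈ IsManifold.maximalAtlas (𝓡 n) ∞ M) :
    IsLocalFinsler (coordDom φ F.dom) (coordFun φ F.L) where
  isOpen := isOpen_coordDom hφ F.isOpen_dom
  smooth := contDiffOn_coordFun hφ F.smooth
  det_ne_zero := F.nondegenerate φ hφ
  euler z hz := by
    refine (euler_of_homogeneous (isOpen_coordDom hφ F.isOpen_dom)
      ((contDiffOn_coordFun hφ F.smooth).pow 2) 2 (fun x y hxy t ht => ?_) hz).trans (by simp)
    have h : coordFun φ F.L (x, t • y) = t * coordFun φ F.L (x, y) := by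
      rw [coordFun, param_smul, F.homogeneous _ _ _ ht hxy.2]; rfl
    simp only [h, mul_pow]

/-- The components are values of `β` on the coordinate vector fields, so they inherit its smoothness
on `TM`. -/
theorem contDiffOn_coordForm (hφ : φ ∈ IsManifold.maximalAtlas (𝓡 n) ∞ M)
    (hb : ContMDiff (𝓡 n).tangent 𝓘(ℝ, ℝ) ∞ (formFun b)) (i : Fin n) :
    ContDiffOn ℝ ∞ (coordForm φ b i) {z | z.1 ∈ φ.target} :=
  (contDiffOn_coordFun hφ hb.contMDiffOn (A := Set.univ)).comp
    (g := coordFun φ (formFun b)) (f := fun z : E n × E n => (z.1, EuclideanSpace.single i (1 : ℝ)))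
    (contDiff_fst.prodMk contDiff_const).contDiffOn fun _ hz => ⟨hz, trivial⟩

theorem dY_coordForm (hφ : φ ∈ IsManifold.maximalAtlas (𝓡 n) ∞ M)
    (hb : ContMDiff (𝓡 n).tangent 𝓘(ℝ, ℝ) ∞ (formFun b)) (i j : Fin n) {z : E n × E n}
    (hz : z.1 ∈ φ.target) : dY j (coordForm φ b i) z = 0 := by
  have hd := (differentiableAt_of_smoothOn isOpen_fst_preimage_target
    (contDiffOn_coordForm hφ hb i) hz).hasFDerivAt
  have hg : HasDerivAt (fun t : ℝ => z + t • ((0 : E n), EuclideanSpace.single j (1 : ℝ)))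
      ((0 : E n), EuclideanSpace.single j (1 : ℝ)) 0 := by
    simpa using ((hasDerivAt_id (0 : ℝ)).smul_const
      ((0 : E n), EuclideanSpace.single j (1 : ℝ))).const_add z
  have h1 := HasFDerivAt.comp_hasDerivAt (0 : ℝ) (by simpa using hd) hg
  refine h1.unique ?_
  have : (coordForm φ b i ∘ fun t : ℝ => z + t • ((0 : E n), EuclideanSpace.single j (1 : ℝ))) =
      fun _ => coordForm φ b i z := by
    funext t
    have h : (z + t • ((0 : E n), EuclideanSpace.single j (1 : ℝ))).1 = z.1 := by simp
    exact congrArg (fun x : E n => coordForm φ b i (x, z.2)) h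
  rw [this]
  exact hasDerivAt_const _ _

/-- The form `β` is horizontally constant if it is Cartan-parallel. -/
theorem dX_coordFun_formFun (F : FinslerSpace n M)
    (hφ : φ ∈ IsManifold.maximalAtlas (𝓡 n) ∞ M)
    (hb : ContMDiff (𝓡 n).tangent 𝓘(ℝ, ℝ) ∞ (formFun b)) (hpar : F.IsCartanParallel b)
    {z : E n × E n} (hz : z ∈ coordDom φ F.dom) (j : Fin n) :
    dX j (coordFun φ (formFun b)) z =
      ∑ r, barthel (coordFun φ F.L) r j z * dY r (coordFun φ (formFun b)) z := by
  have hL := F.isLocalFinsler hφ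
  have hd := fun i => differentiableAt_of_smoothOn isOpen_fst_preimage_target
    (contDiffOn_coordForm hφ hb i) hz.1
  have hβ : coordFun φ (formFun b) = fun z => ∑ i, z.2 i * coordForm φ b i z :=
    funext coordFun_formFun
  -- As `b_i` depends on `x` only, `δ_j b_i` is just `∂_j b_i`.
  have hp : ∀ i, dX j (coordForm φ b i) z =
      ∑ r, coordForm φ b r z * cartanCoeff (coordFun φ F.L) r i j z := by
    intro i
    have := hpar φ hφ i j z hz
    simp only [cartanHCov, delta, dY_coordForm hφ hb _ _ hz.1, mul_zero,
      Finset.sum_const_zero, sub_zero] at this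
    linarith
  have h1 : dX j (coordFun φ (formFun b)) z = ∑ i, z.2 i * dX j (coordForm φ b i) z := by
    rw [hβ, dX, fderiv_sum_mul_apply
      (fun i => ((smooth_coord i).differentiable (by simp)) z) hd]
    simp [fderiv_coord, dX]
  have h2 : ∀ r, dY r (coordFun φ (formFun b)) z = coordForm φ b r z := by
    intro r
    rw [hβ, dY_sum_coord_mul hd]
    simp [dY_coordForm hφ hb _ _ hz.1]
  simp only [h1, h2, hp, Finset.mul_sum]
  rw [Finset.sum_comm]
  refine Finset.sum_congr rfl fun r _ => ?_
  rw [← hL.sum_mul_cartanCoeff hz, Finset.sum_mul]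
  exact Finset.sum_congr rfl fun k _ => by ring

end Coordinates

/-! ### Invariance of the spray under the conformal change -/

section Change

variable {n : ℕ} {M : Type*} [TopologicalSpace M] [ChartedSpace (E n) M]
  [IsManifold (𝓡 n) ∞ M] {φ : OpenPartialHomeomorph M (E n)} {F Fbar : FinslerSpace n M}
  {σ : M → ℝ} {b : (p : M) → TangentSpace (𝓡 n) p →L[ℝ] ℝ} {D : Set (ℝ × ℝ)} {f : ℝ × ℝ → ℝ}

theorem IsGenBetaConformalChange.coordDom_subset
    (h : IsGenBetaConformalChange F Fbar σ b D f) : coordDom φ Fbar.dom ⊆ coordDom φ F.dom :=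
  fun _ hz => ⟨hz.1, h.dom_subset hz.2⟩

/-- The square of the transformed Finsler function is horizontally constant. -/
theorem IsGenBetaConformalChange.horizontal (h : IsGenBetaConformalChange F Fbar σ b D f)
    (hφ : φ ∈ IsManifold.maximalAtlas (𝓡 n) ∞ M) (hb : F.IsCartanParallel b)
    (hσ : IsHomothetic (n := n) σ) {z : E n × E n} (hz : z ∈ coordDom φ Fbar.dom) (j : Fin n) :
    dX j (fun w => coordFun φ Fbar.L w ^ 2) z =
      ∑ r, barthel (coordFun φ F.L) r j z * dY r (fun w => coordFun φ Fbar.L w ^ 2) z := by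
  have hL := F.isLocalFinsler hφ
  have hK := Fbar.isLocalFinsler hφ
  have hzF := h.coordDom_subset hz
  set L := coordFun φ F.L
  set β := coordFun φ (formFun b)
  set c : ℝ := Real.exp (σ (φ.symm z.1))
  have hLd : DifferentiableAt ℝ L z := differentiableAt_of_smoothOn hL.isOpen hL.smooth hzF
  have hβd : DifferentiableAt ℝ β z :=
    differentiableAt_of_smoothOn (isOpen_coordDom hφ isOpen_univ)
      (contDiffOn_coordFun hφ h.smooth_β.contMDiffOn (A := Set.univ)) ⟨hz.1, trivial⟩
  have hf : DifferentiableAt ℝ f (c * L z, β z) :=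
    differentiableAt_of_smoothOn h.isOpen_D h.smooth_f (h.mem_D _ hz.2)
  have hsd := (hasFDerivAt_comp_symm_of_isHomothetic hφ h.smooth_σ hσ hz.1).exp
  have hg : HasFDerivAt (fun w : E n × E n => (Real.exp (σ (φ.symm w.1)) * L w, β w))
      ((c • fderiv ℝ L z).prod (fderiv ℝ β z)) z := by
    have h1 := hsd.mul hLd.hasFDerivAt
    simp only [smul_zero, add_zero] at h1
    exact h1.prodMk hβd.hasFDerivAt
  have hcomp := (hf.hasFDerivAt.comp z hg).pow 2
  have heq : (fun w => coordFun φ Fbar.L w ^ 2) =ᶠ[nhds z]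
      fun x => (f ∘ fun w : E n × E n => (Real.exp (σ (φ.symm w.1)) * L w, β w)) x ^ 2 := by
    filter_upwards [hK.isOpen.mem_nhds hz] with w hw
    simp only [coordFun, h.L_eq _ hw.2]
    rfl
  -- The differential of `L̄²` is a combination of `dL` and `dβ` with coefficients independent of
  -- the direction, so horizontality of `L` and `β` passes to `L̄²`.
  have hv : ∀ v, fderiv ℝ (fun w => coordFun φ Fbar.L w ^ 2) z v =
      2 * f (c * L z, β z) * (fderiv ℝ f (c * L z, β z) (c, 0) * fderiv ℝ L z v +
        fderiv ℝ f (c * L z, β z) (0, 1) * fderiv ℝ β z v) := by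
    intro v
    rw [heq.fderiv_eq, hcomp.fderiv]
    change 2 • f (c * L z, β z) ^ 1 *
      fderiv ℝ f (c * L z, β z) (c * fderiv ℝ L z v, fderiv ℝ β z v) = _
    have hs : ((c * fderiv ℝ L z v, fderiv ℝ β z v) : ℝ × ℝ) =
      fderiv ℝ L z v • ((c, 0) : ℝ × ℝ) + fderiv ℝ β z v • ((0, 1) : ℝ × ℝ) := by
      ext <;> simp [mul_comm]
    rw [hs, map_add, map_smul, map_smul, smul_eq_mul, smul_eq_mul, nsmul_eq_mul]
    push_cast
    ring
  have hLh : dX j L z = ∑ r, barthel L r j z * dY r L z := by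
    have h1 := hL.sum_barthel_mul_dY_sq hzF j
    have hsq : ∀ v, fderiv ℝ (fun w => L w ^ 2) z v = 2 * L z * fderiv ℝ L z v := by
      intro v
      rw [(hLd.hasFDerivAt.pow 2).fderiv]; simp
    have h2 : ∑ r, barthel L r j z * dY r (fun w => L w ^ 2) z =
        2 * L z * ∑ r, barthel L r j z * dY r L z := by
      rw [Finset.mul_sum]
      refine Finset.sum_congr rfl fun r _ => ?_
      rw [dY, hsq, dY]; ring
    rw [h2, dX, hsq] at h1
    -- Positivity of `L` passes from `L²` back to `L`.
    have hpos : 2 * L z ≠ 0 := mul_ne_zero two_ne_zero (F.pos _ hzF.2).ne'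
    exact (mul_left_cancel₀ hpos h1).symm
  have hβh : dX j β z = ∑ r, barthel L r j z * dY r β z :=
    dX_coordFun_formFun F hφ h.smooth_β hb hzF j
  rw [dX, hv]
  change _ * (_ * dX j L z + _ * dX j β z) = _
  rw [hLh, hβh, Finset.mul_sum, Finset.mul_sum, ← Finset.sum_add_distrib, Finset.mul_sum]
  refine Finset.sum_congr rfl fun r _ => ?_
  rw [dY, dY, dY, hv]; ring

/-- The sprays agree on an open set, hence so do their second `y`-derivatives. -/
theorem IsGenBetaConformalChange.berwaldCoeff_eq (h : IsGenBetaConformalChange F Fbar σ b D f)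
    (hφ : φ ∈ IsManifold.maximalAtlas (𝓡 n) ∞ M) (hb : F.IsCartanParallel b)
    (hσ : IsHomothetic (n := n) σ) {z : E n × E n} (hz : z ∈ coordDom φ Fbar.dom)
    (i j k : Fin n) :
    berwaldCoeff (coordFun φ Fbar.L) i j k z = berwaldCoeff (coordFun φ F.L) i j k z := by
  have hU := isOpen_coordDom hφ Fbar.isOpen_dom
  refine fderiv_apply_congr hU (fun z hz => fderiv_apply_congr hU (fun z hz => ?_) hz _) hz _
  exact spray_eq_of_horizontal (F.isLocalFinsler hφ) (Fbar.isLocalFinsler hφ) h.coordDom_subset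
    (fun z hz j => h.horizontal hφ hb hσ hz j) hz i

end Change

end FinslerGeometry

theorem mainTheorem7 {n : ℕ} {M : Type*} [TopologicalSpace M]
    [ChartedSpace (EuclideanSpace ℝ (Fin n)) M] [IsManifold (𝓡 n) ∞ M]
    (F Fbar : FinslerGeometry.FinslerSpace n M) (σ : M → ℝ)
    (b : (p : M) → TangentSpace (𝓡 n) p →L[ℝ] ℝ) (D : Set (ℝ × ℝ)) (f : ℝ × ℝ → ℝ)
    (hchange : FinslerGeometry.IsGenBetaConformalChange F Fbar σ b D f)
    (hb : F.IsCartanParallel b) (hσ : FinslerGeometry.IsHomothetic (n := n) σ)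
    (hF : F.IsBerwald) :
    Fbar.IsBerwald := by
  intro φ hφ i j k x y y' hy hy'
  rw [hchange.berwaldCoeff_eq hφ hb hσ hy, hchange.berwaldCoeff_eq hφ hb hσ hy']
  exact hF φ hφ i j k x y y' (hchange.coordDom_subset hy) (hchange.coordDom_subset hy')
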